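/- Let $(\Omega,\mathcal F,\mathbb P)$ be a probability space, let $m\ge 1$ and $n$ be natural numbers, let $\mathcal U_0\subseteq\mathcal U_1\subseteq\dots\subseteq\mathcal U_m\subseteq\mathcal F$ be a filtration, and let $\bar\sigma=(\bar\sigma_1,\dots,\bar\sigma_m)\in\mathbb R^m$ satisfy $\bar\sigma_k\ne 0$ for all $k$. Write $\|\cdot\|$ for the Euclidean norm of vectors and for the spectral norm of matrices. Let $X_1,\dots,X_m$ be random real symmetric $n\times n$ matrices on $\Omega$ such that, for every $k\in\{1,\dots,m\}$, $X_k$ is $\mathcal U_k$-measurable, $\exp(\|X_k\|^2/\bar\sigma_k^2)$ is integrable, and, almost surely, $$\mathbb E[X_k\mid\mathcal U_{k-1}]=0\qquad\text{and}\qquad \mathbb E\big[\exp(\|X_k\|^2/\bar\sigma_k^2)\,\big|\,\mathcal U_{k-1}\big]\le e .$$ Then for every $\tau>0$, almost surely, $$\mathbb P\Big(\Big\|\sum_{k=1}^m X_k\Big\|\ge\tau\|\bar\sigma\|\;\Big|\;\mathcal U_0\Big)\le 2n\,\exp(-\tau^2/3).$$ Here $\mathbb P(S\mid\mathcal U_0)=\mathbb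 E[\mathbf 1_S\mid\mathcal U_0]$. -/

import Mathlib

-- `‖A‖` for a real matrix `A` is the spectral norm (operator norm for the Euclidean norm).
open scoped Matrix.Norms.L2Operator
open MeasureTheory ProbabilityTheory

/-! This is the matrix Laplace transform method. For symmetric `S`, `exp (l‖S‖)` is at most `tr exp
(l S) + tr exp (-l S)`, so by Markov it suffices to bound the conditional trace exponential moments
of the sum, for `l` and `-l`. Increments are peeled off one at a time. Golden–Thompson
(`trace_exp_add_le`) gives `tr exp (S + l X) ≤ tr (exp S * exp (l X))`, with `exp S` known before
`X`. On the spectrum of `l X`, `exp` lies below a function affine in the argument and in `exp (‖X‖²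
/ s²)` (`exists_exp_le_affine`). Conditioning kills the linear term and bounds the other, at the
cost of a factor `exp (3/4 l² s²)` (`condExp_trace_exp_add_le`). Iterating from `tr 1 = n` and
optimizing `l` gives the claim. -/

/-! ### Lie product formula. -/

theorem norm_pow_sub_pow_le {𝔸 : Type*} [NormedRing 𝔸] [NormOneClass 𝔸] {x y : 𝔸} {M : ℝ}
    (hx : ‖x‖ ≤ M) (hy : ‖y‖ ≤ M) (N : ℕ) :
    ‖x ^ (N + 1) - y ^ (N + 1)‖ ≤ (N + 1) * M ^ N * ‖x - y‖ := by
  induction N with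
  | zero => simp
  | succ N ih =>
    have hM : 0 ≤ M := (norm_nonneg x).trans hx
    have h : x ^ (N + 1 + 1) - y ^ (N + 1 + 1)
        = x ^ (N + 1) * (x - y) + (x ^ (N + 1) - y ^ (N + 1)) * y := by
      rw [pow_succ x (N + 1), pow_succ y (N + 1)]; noncomm_ring
    rw [h]
    calc ‖x ^ (N + 1) * (x - y) + (x ^ (N + 1) - y ^ (N + 1)) * y‖
        ≤ ‖x ^ (N + 1)‖ * ‖x - y‖ + ‖x ^ (N + 1) - y ^ (N + 1)‖ * ‖y‖ :=
          (norm_add_le _ _).trans (add_le_add (norm_mul_le _ _) (norm_mul_le _ _))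
      _ ≤ M ^ (N + 1) * ‖x - y‖ + ((N + 1) * M ^ N * ‖x - y‖) * M := by
          gcongr
          exact (norm_pow_le _ _).trans (by gcongr)
      _ = _ := by push_cast; ring

theorem NormedSpace.norm_exp_le_exp_norm {𝔸 : Type*} [NormedRing 𝔸] [NormOneClass 𝔸]
    [NormedAlgebra ℝ 𝔸] [CompleteSpace 𝔸] (a : 𝔸) : ‖NormedSpace.exp a‖ ≤ Real.exp ‖a‖ := by
  rw [NormedSpace.exp_eq_tsum ℝ, Real.exp_eq_exp_ℝ, NormedSpace.exp_eq_tsum ℝ]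
  refine tsum_of_norm_bounded (NormedSpace.expSeries_summable' (𝕂 := ℝ) ‖a‖).hasSum fun k => ?_
  rw [norm_smul, smul_eq_mul, Real.norm_of_nonneg (by positivity)]
  gcongr
  exact norm_pow_le _ _

open Filter Topology Asymptotics in
/-- The **Lie product formula** in a real Banach algebra. -/
theorem tendsto_exp_mul_exp_pow {𝔸 : Type*} [NormedRing 𝔸] [NormOneClass 𝔸] [NormedAlgebra ℝ 𝔸]
    [CompleteSpace 𝔸] (a b : 𝔸) :
    Tendsto (fun N : ℕ => (NormedSpace.exp ((N + 1 : ℝ)⁻¹ • a)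
      * NormedSpace.exp ((N + 1 : ℝ)⁻¹ • b)) ^ (N + 1)) atTop (𝓝 (NormedSpace.exp (a + b))) := by
  let := NormedAlgebra.restrictScalars ℚ ℝ 𝔸
  set f : ℝ → 𝔸 := fun t => NormedSpace.exp (t • a) * NormedSpace.exp (t • b)
  set g : ℝ → 𝔸 := fun t => NormedSpace.exp (t • (a + b))
  -- `f` and `g` agree to first order at 0, so their gap at `1/(N+1)` is `o(1/N)` and survives the
  -- factor `N + 1` lost in comparing powers.
  have hd : HasDerivAt (fun t => f t - g t) 0 0 := by
    have h1 := hasDerivAt_exp_smul_const (𝕂 := ℝ) a 0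
    have h2 := hasDerivAt_exp_smul_const (𝕂 := ℝ) b 0
    have h3 := hasDerivAt_exp_smul_const (𝕂 := ℝ) (a + b) 0
    convert! (h1.mul h2).sub h3 using 1
    simp
  have ho : (fun t => f t - g t) =o[𝓝 0] fun t : ℝ => t := by
    have := hd.isLittleO
    simpa [f, g] using this
  have hN : Tendsto (fun N : ℕ => ((N : ℝ) + 1)⁻¹) atTop (𝓝 0) := by
    simpa using tendsto_one_div_add_atTop_nhds_zero_nat (𝕜 := ℝ)
  have hsub : Tendsto (fun N : ℕ => f (N + 1 : ℝ)⁻¹ ^ (N + 1) - g (N + 1 : ℝ)⁻¹ ^ (N + 1)) atTop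
      (𝓝 0) := by
    have h1 : (fun N : ℕ => f (N + 1 : ℝ)⁻¹ ^ (N + 1) - g (N + 1 : ℝ)⁻¹ ^ (N + 1)) =O[atTop]
        fun N : ℕ => ((N : ℝ) + 1) * ‖f (N + 1 : ℝ)⁻¹ - g (N + 1 : ℝ)⁻¹‖ := by
      refine IsBigO.of_bound (Real.exp (‖a‖ + ‖b‖)) (Eventually.of_forall fun N => ?_)
      have hN0 : (0 : ℝ) < N + 1 := by positivity
      have hf : ‖f (N + 1 : ℝ)⁻¹‖ ≤ Real.exp ((N + 1 : ℝ)⁻¹ * (‖a‖ + ‖b‖)) := by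
        refine (norm_mul_le _ _).trans ?_
        rw [mul_add, Real.exp_add]
        gcongr <;> refine (NormedSpace.norm_exp_le_exp_norm _).trans_eq ?_ <;>
          rw [norm_smul, Real.norm_of_nonneg (by positivity)]
      have hg : ‖g (N + 1 : ℝ)⁻¹‖ ≤ Real.exp ((N + 1 : ℝ)⁻¹ * (‖a‖ + ‖b‖)) := by
        refine (NormedSpace.norm_exp_le_exp_norm _).trans (Real.exp_le_exp.2 ?_)
        rw [norm_smul, Real.norm_of_nonneg (by positivity)]
        gcongr
        exact norm_add_le _ _
      refine (norm_pow_sub_pow_le hf hg N).trans ?_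
      rw [norm_mul, norm_norm, Real.norm_of_nonneg hN0.le, mul_left_comm, ← mul_assoc]
      gcongr
      rw [← Real.exp_nat_mul]
      refine Real.exp_le_exp.2 ?_
      rw [← mul_assoc]
      refine mul_le_of_le_one_left (by positivity) ?_
      rw [← div_eq_mul_inv, div_le_one hN0]
      linarith
    refine h1.trans_tendsto ?_
    have h2 := (ho.comp_tendsto hN).norm_left.tendsto_div_nhds_zero
    refine h2.congr fun N => ?_
    simp [div_eq_mul_inv, mul_comm]
  have hgN : ∀ N : ℕ, g (N + 1 : ℝ)⁻¹ ^ (N + 1) = NormedSpace.exp (a + b) := fun N => by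
    rw [← NormedSpace.exp_nsmul, ← Nat.cast_smul_eq_nsmul ℝ, smul_smul]
    push_cast
    rw [mul_inv_cancel₀ (by positivity), one_smul]
  simp_rw [hgN] at hsub
  simpa using hsub.add_const (NormedSpace.exp (a + b))

/-! ### Trace inequalities for powers. -/

section
open Matrix
theorem trace_mul_pow_comm {n : Type*} [Fintype n] [DecidableEq n] (A B : Matrix n n ℝ) (p : ℕ) :
    ((A * B) ^ p).trace = ((B * A) ^ p).trace := by
  have h : ∀ p : ℕ, (A * B) ^ (p + 1) = A * ((B * A) ^ p * B) := by
    intro p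
    induction p with
    | zero => simp
    | succ p ih => rw [pow_succ', ih, pow_succ' (B * A)]; simp only [mul_assoc]
  cases p with
  | zero => simp
  | succ p => rw [h, trace_mul_comm, pow_succ, mul_assoc]

theorem trace_transpose_mul_self_nonneg {n : Type*} [Fintype n] (A : Matrix n n ℝ) :
    0 ≤ (Aᵀ * A).trace := by
  simp only [trace, diag, mul_apply, transpose_apply]
  exact Finset.sum_nonneg fun i _ => Finset.sum_nonneg fun j _ => mul_self_nonneg _

theorem abs_trace_mul_self_le {n : Type*} [Fintype n] (A : Matrix n n ℝ) :
    |(A * A).trace| ≤ (Aᵀ * A).trace := by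
  have h1 := trace_transpose_mul_self_nonneg (A + Aᵀ)
  have h2 := trace_transpose_mul_self_nonneg (A - Aᵀ)
  have h3 : (Aᵀ * Aᵀ).trace = (A * A).trace := by rw [← transpose_mul, trace_transpose]
  have h4 : (A * Aᵀ).trace = (Aᵀ * A).trace := trace_mul_comm _ _
  simp only [transpose_add, transpose_sub, transpose_transpose, mul_add, add_mul, mul_sub, sub_mul,
    trace_add, trace_sub] at h1 h2
  rw [abs_le]; constructor <;> linarith

theorem two_mul_trace_mul_le {n : Type*} [Fintype n] {A B : Matrix n n ℝ}
    (hA : A.IsSymm) (hB : B.IsSymm) :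
    2 * (A * B).trace ≤ (A * A).trace + (B * B).trace := by
  have h := trace_transpose_mul_self_nonneg (A - B)
  rw [transpose_sub, hA.eq, hB.eq] at h
  have h4 : (A * B).trace = (B * A).trace := trace_mul_comm _ _
  simp only [mul_sub, sub_mul, trace_sub] at h
  linarith

/-- The two bounds feed each other. The first at `j + 1` is the second for `X = A * B`, cyclicity,
then the first for `A²`, `B²`. The second at `j + 1` is the second for `X²`, cyclicity, then the
first for `XᵀX`, `XXᵀ`, whose powers have equal traces. -/
theorem trace_pow_two_pow_bounds {n : Type*} [Fintype n] [DecidableEq n] (j : ℕ) :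
    (∀ A B : Matrix n n ℝ, A.IsSymm → B.IsSymm →
      ((A * B) ^ 2 ^ j).trace ≤ (A ^ 2 ^ j * B ^ 2 ^ j).trace) ∧
    ∀ X : Matrix n n ℝ, |(X ^ 2 ^ (j + 1)).trace| ≤ ((Xᵀ * X) ^ 2 ^ j).trace := by
  induction j with
  | zero => exact ⟨fun A B _ _ => by simp, fun X => by simpa [pow_two] using abs_trace_mul_self_le X⟩
  | succ j ih =>
    obtain ⟨hL, hK⟩ := ih
    have hsq : ∀ X : Matrix n n ℝ, ∀ i : ℕ, X ^ 2 ^ (i + 1) = (X * X) ^ 2 ^ i := fun X i => by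
      rw [pow_succ', pow_mul, pow_two]
    refine ⟨fun A B hA hB => ?_, fun X => ?_⟩
    · calc ((A * B) ^ 2 ^ (j + 1)).trace ≤ (((A * B)ᵀ * (A * B)) ^ 2 ^ j).trace :=
            (le_abs_self _).trans (hK _)
        _ = ((A * A * (B * B)) ^ 2 ^ j).trace := by
            rw [transpose_mul, hA.eq, hB.eq, mul_assoc, trace_mul_pow_comm]; simp only [mul_assoc]
        _ ≤ _ := by
            rw [hsq A, hsq B]
            exact hL _ _ (by rw [IsSymm, transpose_mul, hA.eq]) (by rw [IsSymm, transpose_mul, hB.eq])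
    · have hP : (Xᵀ * X).IsSymm := isSymm_transpose_mul_self X
      have hQ : (X * Xᵀ).IsSymm := isSymm_mul_transpose_self X
      have hPQ : ((X * Xᵀ) ^ 2 ^ (j + 1)).trace = ((Xᵀ * X) ^ 2 ^ (j + 1)).trace :=
        trace_mul_pow_comm _ _ _
      have h1 := hL _ _ hP hQ
      have h2 := two_mul_trace_mul_le (hP.pow (2 ^ j)) (hQ.pow (2 ^ j))
      rw [← pow_two, ← pow_two, ← pow_mul, ← pow_mul, ← pow_succ, hPQ] at h2
      calc |(X ^ 2 ^ (j + 1 + 1)).trace| ≤ (((X * X)ᵀ * (X * X)) ^ 2 ^ j).trace := by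
            rw [hsq]; exact hK _
        _ = ((Xᵀ * X * (X * Xᵀ)) ^ 2 ^ j).trace := by
            rw [transpose_mul, mul_assoc, trace_mul_pow_comm]; simp only [mul_assoc]
        _ ≤ _ := by linarith

/-! ### Spectral calculus and Golden–Thompson. -/

theorem Matrix.IsSymm.exists_orthogonal_diagonalization {n : Type*} [Fintype n] [DecidableEq n]
    {H : Matrix n n ℝ} (hH : H.IsSymm) :
    ∃ (V : Matrix n n ℝ) (d : n → ℝ), Vᵀ * V = 1 ∧ V * Vᵀ = 1 ∧ H = V * diagonal d * Vᵀ ∧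
      ‖H‖ = ‖d‖ ∧ NormedSpace.exp H = V * diagonal (fun i => Real.exp (d i)) * Vᵀ := by
  have hH' : H.IsHermitian := by rwa [IsHermitian, conjTranspose_eq_transpose_of_trivial]
  set W := hH'.eigenvectorUnitary
  have h1 : (W : Matrix n n ℝ)ᵀ * W = 1 := by
    simpa [star_eq_conjTranspose] using Unitary.coe_star_mul_self W
  have h2 : (W : Matrix n n ℝ) * (W : Matrix n n ℝ)ᵀ = 1 := by
    simpa [star_eq_conjTranspose] using Unitary.coe_mul_star_self W
  have h3 : H = W * diagonal hH'.eigenvalues * (W : Matrix n n ℝ)ᵀ := by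
    have := hH'.spectral_theorem
    rw [Unitary.conjStarAlgAut_apply] at this
    simpa [star_eq_conjTranspose, Function.comp_def] using this
  refine ⟨W, hH'.eigenvalues, h1, h2, h3, ?_, ?_⟩
  · rw [← l2_opNorm_diagonal]
    conv_lhs => rw [h3]
    have : (W : Matrix n n ℝ)ᵀ = ((star W : unitary (Matrix n n ℝ)) : Matrix n n ℝ) := by
      simp [star_eq_conjTranspose]
    rw [this, CStarRing.norm_mul_coe_unitary, CStarRing.norm_coe_unitary_mul]
  · have hinv : (W : Matrix n n ℝ)⁻¹ = (W : Matrix n n ℝ)ᵀ := inv_eq_left_inv h1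
    have hu : IsUnit (W : Matrix n n ℝ) := IsUnit.of_mul_eq_one _ h2
    conv_lhs => rw [h3, ← hinv, exp_conj _ _ hu, exp_diagonal, hinv]
    congr 3
    ext i
    simp [Pi.coe_exp, Real.exp_eq_exp_ℝ]

/-- Tracing a positive semidefinite matrix `S * Sᵀ` against functions of a symmetric matrix `H` is
integration against nonnegative weights on the eigenvalues of `H`. -/
theorem Matrix.IsSymm.exists_trace_weights {n : Type*} [Fintype n] [DecidableEq n] {H : Matrix n n ℝ}
    (hH : H.IsSymm) (S : Matrix n n ℝ) :
    ∃ w d : n → ℝ, (∀ i, 0 ≤ w i) ∧ (∀ i, |d i| ≤ ‖H‖) ∧ (S * Sᵀ).trace = ∑ i, w i ∧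
      (S * Sᵀ * H).trace = ∑ i, w i * d i ∧
      (S * Sᵀ * NormedSpace.exp H).trace = ∑ i, w i * Real.exp (d i) := by
  obtain ⟨V, d, hV, hV', hd, hnorm, hexp⟩ := hH.exists_orthogonal_diagonalization
  have key : ∀ v : n → ℝ, (S * Sᵀ * (V * diagonal v * Vᵀ)).trace
      = ∑ i, (Vᵀ * S * (Vᵀ * S)ᵀ) i i * v i := fun v => by
    rw [← mul_assoc, trace_mul_comm, ← mul_assoc, ← mul_assoc, transpose_mul, transpose_transpose]
    simp only [trace, diag, mul_diagonal, mul_assoc]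
  refine ⟨fun i => (Vᵀ * S * (Vᵀ * S)ᵀ) i i, d, fun i => ?_,
    fun i => hnorm ▸ norm_le_pi_norm d i, ?_, ?_, ?_⟩
  · simp only [mul_apply]
    exact Finset.sum_nonneg fun j _ => mul_self_nonneg _
  · simpa [hV'] using key fun _ => 1
  · rw [← key, ← hd]
  · rw [← key, ← hexp]

/-- The weights are nonnegative, so a scalar inequality on the spectrum can be integrated against
them. -/
theorem Matrix.IsSymm.trace_mul_exp_le {n : Type*} [Fintype n] [DecidableEq n] {H : Matrix n n ℝ}
    (hH : H.IsSymm) (S : Matrix n n ℝ) {a c : ℝ}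
    (hac : ∀ x : ℝ, |x| ≤ ‖H‖ → Real.exp x ≤ a * x + c) :
    (S * Sᵀ * NormedSpace.exp H).trace ≤ a * (S * Sᵀ * H).trace + c * (S * Sᵀ).trace := by
  obtain ⟨w, d, hw, hd, h1, h2, h3⟩ := hH.exists_trace_weights S
  rw [h1, h2, h3, Finset.mul_sum, Finset.mul_sum, ← Finset.sum_add_distrib]
  refine Finset.sum_le_sum fun i _ => ?_
  linarith [mul_le_mul_of_nonneg_left (hac (d i) (hd i)) (hw i)]

theorem Matrix.IsSymm.abs_trace_mul_le {n : Type*} [Fintype n] [DecidableEq n] {H : Matrix n n ℝ}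
    (hH : H.IsSymm) (S : Matrix n n ℝ) :
    |(S * Sᵀ * H).trace| ≤ (S * Sᵀ).trace * ‖H‖ := by
  obtain ⟨w, d, hw, hd, h1, h2, -⟩ := hH.exists_trace_weights S
  rw [h1, h2, Finset.sum_mul]
  refine (Finset.abs_sum_le_sum_abs _ _).trans (Finset.sum_le_sum fun i _ => ?_)
  rw [abs_mul, abs_of_nonneg (hw i)]
  exact mul_le_mul_of_nonneg_left (hd i) (hw i)

theorem Matrix.IsSymm.exp_eq_mul_transpose {n : Type*} [Fintype n] [DecidableEq n] {H : Matrix n n ℝ}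
    (hH : H.IsSymm) : NormedSpace.exp H
      = NormedSpace.exp ((2 : ℝ)⁻¹ • H) * (NormedSpace.exp ((2 : ℝ)⁻¹ • H))ᵀ := by
  rw [(hH.smul _).exp.eq, ← pow_two, ← Matrix.exp_nsmul, ← Nat.cast_smul_eq_nsmul ℝ, smul_smul]
  simp

theorem Matrix.IsSymm.trace_exp_nonneg {n : Type*} [Fintype n] [DecidableEq n] {H : Matrix n n ℝ}
    (hH : H.IsSymm) : 0 ≤ (NormedSpace.exp H).trace := by
  rw [hH.exp_eq_mul_transpose, trace_mul_comm]
  exact trace_transpose_mul_self_nonneg _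

/-- The norm is `|d i|` for some eigenvalue `d i`; one of the two traces contains `exp |d i|`, and
all other terms are positive. -/
theorem Matrix.IsSymm.exp_norm_le_trace_exp_add {n : Type*} [Fintype n] [DecidableEq n] [Nonempty n]
    {H : Matrix n n ℝ} (hH : H.IsSymm) :
    Real.exp ‖H‖ ≤ (NormedSpace.exp H).trace + (NormedSpace.exp (-H)).trace := by
  obtain ⟨V, d, hV, hV', hd, hnorm, hexp⟩ := Matrix.IsSymm.exists_orthogonal_diagonalization hH
  have hu : IsUnit V := IsUnit.of_mul_eq_one _ hV'
  have hinv : V⁻¹ = Vᵀ := inv_eq_left_inv hV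
  have hexp' : NormedSpace.exp (-H) = V * diagonal (fun i => Real.exp (-d i)) * Vᵀ := by
    have : -H = V * diagonal (-d) * Vᵀ := by
      rw [hd, ← show -diagonal d = diagonal (-d) from diagonal_neg d, mul_neg, neg_mul]
    rw [this, ← hinv, exp_conj _ _ hu, exp_diagonal]
    congr 3
    ext i
    simp [Pi.coe_exp, Real.exp_eq_exp_ℝ]
  obtain ⟨i, hi⟩ := Finite.exists_max fun i => |d i|
  have hle : ‖d‖ ≤ |d i| := (pi_norm_le_iff_of_nonneg (abs_nonneg _)).2 hi
  rw [hexp, hexp', trace_mul_comm, ← mul_assoc, hV, one_mul, trace_mul_comm, ← mul_assoc, hV,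
    one_mul, trace_diagonal, trace_diagonal, ← Finset.sum_add_distrib, hnorm]
  calc Real.exp ‖d‖ ≤ Real.exp |d i| := Real.exp_le_exp.2 hle
    _ ≤ Real.exp (d i) + Real.exp (-d i) := by
        rcases abs_cases (d i) with ⟨h, _⟩ | ⟨h, _⟩ <;> rw [h] <;>
          linarith [Real.exp_pos (d i), Real.exp_pos (-d i)]
    _ ≤ _ := Finset.single_le_sum (f := fun i => Real.exp (d i) + Real.exp (-d i))
        (fun j _ => by positivity) (Finset.mem_univ i)

open Filter Topology in
/-- The **Golden–Thompson inequality** for real symmetric matrices. -/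
theorem trace_exp_add_le {n : Type*} [Fintype n] [DecidableEq n] {A B : Matrix n n ℝ}
    (hA : A.IsSymm) (hB : B.IsSymm) :
    (NormedSpace.exp (A + B)).trace ≤ (NormedSpace.exp A * NormedSpace.exp B).trace := by
  -- The Lie formula needs `‖1‖ = 1`, which fails for empty matrices.
  rcases isEmpty_or_nonempty n with hn | hn
  · simp [trace]
  -- Restrict to exponents `N + 1 = 2 ^ j`, where the trace bound for powers applies.
  have hN : Tendsto (fun j : ℕ => 2 ^ j - 1) atTop atTop :=
    (tendsto_sub_atTop_nat 1).comp (tendsto_pow_atTop_atTop_of_one_lt one_lt_two)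
  have hT := ((continuous_id.matrix_trace.tendsto _).comp (tendsto_exp_mul_exp_pow A B)).comp hN
  refine le_of_tendsto hT (Eventually.of_forall fun j => ?_)
  have hj : 2 ^ j - 1 + 1 = 2 ^ j := Nat.sub_add_cancel Nat.one_le_two_pow
  have hj' : ((2 ^ j - 1 : ℕ) : ℝ) + 1 = 2 ^ j := by exact_mod_cast hj
  have hpow : ∀ C : Matrix n n ℝ,
      NormedSpace.exp (((2 : ℝ) ^ j)⁻¹ • C) ^ 2 ^ j = NormedSpace.exp C := fun C => by
    rw [← Matrix.exp_nsmul, ← Nat.cast_smul_eq_nsmul ℝ, smul_smul]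
    push_cast
    rw [mul_inv_cancel₀ (by positivity), one_smul]
  simp only [Function.comp_apply, id_eq, hj, hj']
  refine ((trace_pow_two_pow_bounds j).1 _ _ (hA.smul _).exp (hB.smul _).exp).trans_eq ?_
  rw [hpow, hpow]

end

/-! ### Scalar exponential inequalities. -/

section
open Real
theorem exp_le_taylor {x : ℝ} (h0 : 0 ≤ x) (h2 : x ≤ 2) :
    exp x ≤ 1 + x + x ^ 2 / 2 + x ^ 3 / 6 + x ^ 4 / 24 + x ^ 5 / 120 + x ^ 6 / 360 := by
  have h := Complex.exp_bound' (x := (x : ℂ)) (n := 6) (by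
    rw [Complex.norm_real, norm_of_nonneg h0]; norm_num; linarith)
  rw [Complex.norm_real, norm_of_nonneg h0] at h
  have h' : ‖exp x - ∑ m ∈ Finset.range 6, x ^ m / m.factorial‖ ≤ x ^ 6 / (Nat.factorial 6) * 2 := by
    rw [← Complex.norm_real]; push_cast; exact h
  have := (le_abs_self _).trans h'
  simp [Finset.sum_range_succ, Nat.factorial] at this
  linarith

/-- For `x ≤ 0` a quadratic bound suffices; on `(0, 2]` Taylor polynomials are compared; beyond 2,
already `x ≤ 9x²/16`. -/
theorem exp_le_add_exp_sq (x : ℝ) : exp x ≤ x + exp (9 * x ^ 2 / 16) := by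
  have hlow : 1 + 9 * x ^ 2 / 16 ≤ exp (9 * x ^ 2 / 16) := by
    linarith [add_one_le_exp (9 * x ^ 2 / 16)]
  rcases le_or_gt x 0 with hx | hx
  · have h := quadratic_le_exp_of_nonneg (neg_nonneg.2 hx)
    have h1 : exp x * exp (-x) = 1 := by rw [← exp_add]; simp
    have hq : (1 + x + x ^ 2 / 2) * (1 + -x + (-x) ^ 2 / 2) ≥ 1 := by nlinarith [sq_nonneg (x^2)]
    have hpos : 0 < 1 + x + x ^ 2 / 2 := by nlinarith [sq_nonneg (x + 1)]
    have : exp x ≤ 1 + x + x ^ 2 / 2 := by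
      have h3 : 1 ≤ (1 + x + x ^ 2 / 2) * exp (-x) := hq.le.trans (by gcongr)
      calc exp x = exp x * 1 := by ring
        _ ≤ exp x * ((1 + x + x ^ 2 / 2) * exp (-x)) := by gcongr
        _ = (1 + x + x ^ 2 / 2) * (exp x * exp (-x)) := by ring
        _ = _ := by rw [h1, mul_one]
    nlinarith [sq_nonneg x]
  rcases le_or_gt x 2 with hx2 | hx2
  · have h := exp_le_taylor hx.le hx2
    have h3 := sum_le_exp_of_nonneg (show 0 ≤ 9 * x ^ 2 / 16 by positivity) 4
    simp only [Finset.sum_range_succ, Finset.sum_range_zero, Nat.factorial] at h3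
    norm_num at h3
    have hp : 0 ≤ x ^ 2 * (1 / 16 - x / 6 + (81 / 512 - 1 / 24) * x ^ 2 - x ^ 3 / 120
        + (729 / 24576 - 1 / 360) * x ^ 4) := by
      apply mul_nonneg (sq_nonneg x)
      nlinarith [sq_nonneg (x^2 - 1/2), sq_nonneg (x^2 -3/4*x), sq_nonneg (x - 3/4), sq_nonneg (x^2 - x/8-1/2), sq_nonneg (x^2 + x-1), sq_nonneg (x-0.72), sq_nonneg (x*(x-0.7))]
    nlinarith
  · have : exp x ≤ exp (9 * x ^ 2 / 16) := exp_le_exp.2 (by nlinarith)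
    linarith

/-- A majorant of `exp` on `[-|l| r, |l| r]` that is affine in the argument and in
`exp (r ^ 2 / s ^ 2)`. -/
theorem exists_exp_le_affine (l : ℝ) {s : ℝ} (hs : s ≠ 0) :
    ∃ a α β : ℝ, 0 ≤ α ∧ 0 ≤ β ∧ α * exp 1 + β ≤ exp (3 / 4 * l ^ 2 * s ^ 2) ∧
      ∀ r x : ℝ, |x| ≤ |l| * r → exp x ≤ a * x + (α * exp (r ^ 2 / s ^ 2) + β) := by
  have hs2 : 0 < s ^ 2 := by positivity
  -- Convexity of `exp` between `0` and `q - 1`: the chord is exact at `q = 1`, so replacing `exp q`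
  -- by `e` gives `exp p` (`hsum`).
  have hconv : ∀ p q : ℝ, 0 ≤ p → p ≤ 1 →
      exp (p * q) ≤ exp p * (p * exp (-1)) * exp q + exp p * (1 - p) := fun p q h0 h1 => by
    have h := convexOn_exp.2 (Set.mem_univ (q - 1)) (Set.mem_univ 0) h0 (sub_nonneg.2 h1) (by ring)
    simp only [smul_eq_mul, mul_zero, add_zero, exp_zero, mul_one, exp_sub] at h
    have h2 : exp (p * q) = exp p * exp (p * (q - 1)) := by rw [← exp_add]; congr 1; ring
    rw [h2, exp_neg]
    calc exp p * exp (p * (q - 1)) ≤ exp p * (p * (exp q / exp 1) + (1 - p)) := by gcongr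
      _ = _ := by rw [div_eq_mul_inv]; ring
  have hsum : ∀ p : ℝ, exp p * (p * exp (-1)) * exp 1 + exp p * (1 - p) = exp p := fun p => by
    rw [show exp p * (p * exp (-1)) * exp 1 = exp p * p * (exp (-1) * exp 1) by ring, ← exp_add]
    simp; ring
  have hsq : ∀ r x : ℝ, |x| ≤ |l| * r → x ^ 2 ≤ l ^ 2 * r ^ 2 := fun r x h => by
    rw [← sq_abs x, ← sq_abs l, ← mul_pow]
    gcongr
  rcases le_or_gt (9 / 16 * l ^ 2 * s ^ 2) 1 with hl | hl
  · set p := 9 / 16 * l ^ 2 * s ^ 2 with hp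
    have hp0 : 0 ≤ p := by positivity
    refine ⟨1, exp p * (p * exp (-1)), exp p * (1 - p), by positivity,
      mul_nonneg (exp_pos _).le (sub_nonneg.2 hl), ?_, fun r x hx => ?_⟩
    · rw [hsum]
      refine exp_le_exp.2 ?_
      have : 0 ≤ l ^ 2 * s ^ 2 := by positivity
      linarith
    · have h1 : exp (9 * x ^ 2 / 16) ≤ exp (p * (r ^ 2 / s ^ 2)) := by
        refine exp_le_exp.2 ?_
        have : p * (r ^ 2 / s ^ 2) = 9 / 16 * (l ^ 2 * r ^ 2) := by rw [hp]; field_simp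
        rw [this]
        linarith [hsq r x hx]
      linarith [exp_le_add_exp_sq x, hconv p (r ^ 2 / s ^ 2) hp0 hl]
  -- For large `l` no linear term is needed: AM-GM splits `|l| r`, and `3/8 l² s² + 2/3 ≤ 3/4 l² s²`
  -- holds exactly when `l² s² ≥ 16/9`, the case boundary.
  · set K := exp (3 / 8 * l ^ 2 * s ^ 2) with hK
    refine ⟨0, K * (exp (2 / 3) * (2 / 3 * exp (-1))), K * (exp (2 / 3) * (1 - 2 / 3)),
      by positivity, mul_nonneg (exp_pos _).le (mul_nonneg (exp_pos _).le (by norm_num)), ?_,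
      fun r x hx => ?_⟩
    · rw [mul_assoc, ← mul_add, hsum, hK, ← exp_add]
      refine exp_le_exp.2 ?_
      linarith
    · have h1 : x ≤ 3 / 8 * l ^ 2 * s ^ 2 + 2 / 3 * (r ^ 2 / s ^ 2) := by
        have h2 : |l| * r ≤ 3 / 8 * l ^ 2 * s ^ 2 + 2 / 3 * (r ^ 2 / s ^ 2) := by
          have h3 := sq_nonneg (3 / 4 * |l| * |s| - r / |s|)
          have h4 : (3 / 4 * |l| * |s| - r / |s|) ^ 2
              = 9 / 16 * l ^ 2 * s ^ 2 - 3 / 2 * (|l| * r) + r ^ 2 / s ^ 2 := by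
            have : |s| ≠ 0 := abs_ne_zero.2 hs
            rw [← sq_abs l, ← sq_abs s]
            field_simp
            ring
          linarith
        exact (le_abs_self x).trans (hx.trans h2)
      have h5 := hconv (2 / 3) (r ^ 2 / s ^ 2) (by norm_num) (by norm_num)
      calc exp x ≤ K * exp (2 / 3 * (r ^ 2 / s ^ 2)) := by rw [hK, ← exp_add]; exact exp_le_exp.2 h1
        _ ≤ K * (exp (2 / 3) * (2 / 3 * exp (-1)) * exp (r ^ 2 / s ^ 2)
              + exp (2 / 3) * (1 - 2 / 3)) := by gcongr
        _ = _ := by ring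

theorem le_abs_mul_exp_sq_div (r : ℝ) {s : ℝ} (hs : s ≠ 0) :
    r ≤ |s| * exp (r ^ 2 / s ^ 2) := by
  have h0 : 0 < |s| := abs_pos.2 hs
  have h1 : r / |s| ≤ exp (r ^ 2 / s ^ 2) := by
    rw [← sq_abs s, ← div_pow]
    nlinarith [add_one_le_exp ((r / |s|) ^ 2), sq_nonneg (r / |s| - 1)]
  rwa [div_le_iff₀' h0] at h1

end

/-! ### Conditional moment bounds. -/

section
open Matrix

/-- A nonnegative integrable `m`-measurable function times a nonnegative function with bounded
conditional expectation given `m` is integrable. -/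
theorem integrable_mul_of_condExp_le {Ω : Type*} {m mΩ : MeasurableSpace Ω} {P : Measure Ω}
    [IsFiniteMeasure P] (hm : m ≤ mΩ) {Z Y : Ω → ℝ} {C : ℝ} (hZm : StronglyMeasurable[m] Z)
    (hZ : Integrable Z P) (hZ0 : 0 ≤ Z) (hY : Integrable Y P) (hYm : Measurable Y) (hY0 : 0 ≤ Y)
    (hC : P[Y | m] ≤ᵐ[P] fun _ => C) : Integrable (Z * Y) P := by
  refine ⟨(hZm.mono hm).aestronglyMeasurable.mul hY.aestronglyMeasurable, ?_⟩
  have hZY0 : 0 ≤ᵐ[P] Z * Y := Filter.Eventually.of_forall fun ω => mul_nonneg (hZ0 ω) (hY0 ω)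
  rw [hasFiniteIntegral_iff_ofReal hZY0]
  -- On `m`-measurable sets the measure with density `Y` is at most `C • P`; integrating the
  -- `m`-measurable `Z` against both avoids assuming `Z * Y` integrable.
  have hle : (P.withDensity fun ω => ENNReal.ofReal (Y ω)).trim hm
      ≤ ENNReal.ofReal C • P.trim hm := by
    refine Measure.le_intro fun s hs _ => ?_
    rw [trim_measurableSet_eq hm hs, withDensity_apply _ (hm s hs), Measure.smul_apply,
      trim_measurableSet_eq hm hs, ← ofReal_integral_eq_lintegral_ofReal hY.integrableOn
        (Filter.Eventually.of_forall hY0), ← setIntegral_condExp hm hY hs]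
    have h1 : ∫ ω in s, (P[Y | m]) ω ∂P ≤ ∫ _ in s, C ∂P :=
      setIntegral_mono_ae integrable_condExp.integrableOn (integrable_const _).integrableOn hC
    rw [setIntegral_const, smul_eq_mul] at h1
    refine (ENNReal.ofReal_le_ofReal h1).trans_eq ?_
    rw [ENNReal.ofReal_mul measureReal_nonneg, ofReal_measureReal, mul_comm, smul_eq_mul]
  have hZm' : Measurable[m] fun ω => ENNReal.ofReal (Z ω) := hZm.measurable.ennreal_ofReal
  calc ∫⁻ ω, ENNReal.ofReal ((Z * Y) ω) ∂P
      = ∫⁻ ω, ENNReal.ofReal (Z ω) ∂(P.withDensity fun ω => ENNReal.ofReal (Y ω)) := by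
        rw [lintegral_withDensity_eq_lintegral_mul _ hYm.ennreal_ofReal (hZm'.mono hm le_rfl)]
        refine lintegral_congr fun ω => ?_
        simp [ENNReal.ofReal_mul (hZ0 ω), mul_comm]
    _ ≤ ∫⁻ ω, ENNReal.ofReal (Z ω) ∂(ENNReal.ofReal C • P.trim hm) := by
        rw [← lintegral_trim hm hZm']
        exact lintegral_mono' hle le_rfl
    _ = ENNReal.ofReal C * ∫⁻ ω, ENNReal.ofReal (Z ω) ∂P := by
        rw [lintegral_smul_measure, lintegral_trim hm hZm', smul_eq_mul]
    _ < ⊤ := ENNReal.mul_lt_top ENNReal.ofReal_lt_top hZ.lintegral_lt_top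

theorem condExp_trace_exp_add_le {Ω : Type*} {m mΩ : MeasurableSpace Ω} {P : Measure Ω}
    [IsProbabilityMeasure P] (hm : m ≤ mΩ) {n : Type*} [Fintype n] [DecidableEq n]
    {S X : Ω → Matrix n n ℝ} {s : ℝ} (hs : s ≠ 0) (l : ℝ)
    (hSs : ∀ ω, (S ω).IsSymm) (hXs : ∀ ω, (X ω).IsSymm)
    (hSm : StronglyMeasurable[m] S) (hXm : StronglyMeasurable X)
    (hX : P[X | m] =ᵐ[P] 0)
    (hY : Integrable (fun ω => Real.exp (‖X ω‖ ^ 2 / s ^ 2)) P)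
    (hYe : P[fun ω => Real.exp (‖X ω‖ ^ 2 / s ^ 2) | m] ≤ᵐ[P] fun _ => Real.exp 1)
    (hW : Integrable (fun ω => (NormedSpace.exp (S ω)).trace) P) :
    Integrable (fun ω => (NormedSpace.exp (S ω + l • X ω)).trace) P ∧
      P[fun ω => (NormedSpace.exp (S ω + l • X ω)).trace | m] ≤ᵐ[P]
        fun ω => Real.exp (3 / 4 * l ^ 2 * s ^ 2) * (NormedSpace.exp (S ω)).trace := by
  obtain ⟨a, α, β, hα, hβ, hαβ, hbd⟩ := exists_exp_le_affine l hs
  set Y : Ω → ℝ := fun ω => Real.exp (‖X ω‖ ^ 2 / s ^ 2) with hYdef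
  set E : Ω → Matrix n n ℝ := fun ω => NormedSpace.exp (S ω) with hE
  set W : Ω → ℝ := fun ω => (E ω).trace with hWdef
  have hexpc : Continuous (NormedSpace.exp : Matrix n n ℝ → Matrix n n ℝ) :=
    let := NormedAlgebra.restrictScalars ℚ ℝ (Matrix n n ℝ)
    NormedSpace.exp_continuous
  have hEm : StronglyMeasurable[m] E := hexpc.comp_stronglyMeasurable hSm
  have hWm : StronglyMeasurable[m] W := continuous_id.matrix_trace.comp_stronglyMeasurable hEm
  have hYm : Measurable Y := ((hXm.norm.measurable.pow_const 2).div_const _).exp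
  have hW0 : 0 ≤ W := fun ω => (hSs ω).trace_exp_nonneg
  have hY0 : 0 ≤ Y := fun ω => (Real.exp_pos _).le
  have hWY : Integrable (W * Y) P := integrable_mul_of_condExp_le hm hWm hW hW0 hY hYm hY0 hYe
  have hXY : ∀ ω, ‖X ω‖ ≤ |s| * Y ω := fun ω => le_abs_mul_exp_sq_div _ hs
  have hXint : Integrable X P :=
    (hY.const_mul |s|).mono' hXm.aestronglyMeasurable (Filter.Eventually.of_forall hXY)
  -- The trace pairing as a continuous bilinear map, so that the known factor `E` can be pulled out
  -- of the conditional expectation.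
  let B : Matrix n n ℝ →L[ℝ] Matrix n n ℝ →L[ℝ] ℝ :=
    (ContinuousLinearMap.compL ℝ (Matrix n n ℝ) (Matrix n n ℝ) ℝ
      (LinearMap.toContinuousLinearMap (traceLinearMap n ℝ ℝ))).comp
        (ContinuousLinearMap.mul ℝ (Matrix n n ℝ))
  have hB : ∀ M N, B M N = (M * N).trace := fun M N => rfl
  have hBint : Integrable (fun ω => B (E ω) (X ω)) P := by
    refine (hWY.const_mul |s|).mono'
      (B.aestronglyMeasurable_comp₂ (hEm.mono hm).aestronglyMeasurable hXm.aestronglyMeasurable)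
      (Filter.Eventually.of_forall fun ω => ?_)
    have h := (hXs ω).abs_trace_mul_le (NormedSpace.exp ((2 : ℝ)⁻¹ • S ω))
    rw [← (hSs ω).exp_eq_mul_transpose] at h
    rw [hB]
    calc ‖(E ω * X ω).trace‖ ≤ W ω * ‖X ω‖ := h
      _ ≤ W ω * (|s| * Y ω) := mul_le_mul_of_nonneg_left (hXY ω) (hW0 ω)
      _ = _ := by simp; ring
  have hBc : P[fun ω => B (E ω) (X ω) | m] =ᵐ[P] 0 := by
    filter_upwards [condExp_bilin_of_stronglyMeasurable_left B hEm hBint hXint, hX] with ω h1 h2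
    rw [h1, h2]; simp
  have hWYc : P[W * Y | m] ≤ᵐ[P] fun ω => W ω * Real.exp 1 := by
    filter_upwards [condExp_mul_of_stronglyMeasurable_left hWm hWY hY, hYe] with ω h1 h2
    rw [h1]
    exact mul_le_mul_of_nonneg_left h2 (hW0 ω)
  set R : Ω → ℝ := (a * l) • (fun ω => B (E ω) (X ω)) + (α • (W * Y) + β • W) with hR
  have hRint : Integrable R P := (hBint.smul _).add ((hWY.smul _).add (hW.smul _))
  have hle : ∀ ω, (NormedSpace.exp (S ω + l • X ω)).trace ≤ R ω := fun ω => by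
    refine (trace_exp_add_le (hSs ω) ((hXs ω).smul l)).trans ?_
    have h := ((hXs ω).smul l).trace_mul_exp_le (NormedSpace.exp ((2 : ℝ)⁻¹ • S ω))
      (a := a) (c := α * Y ω + β) fun x hx => hbd _ x (by rwa [norm_smul] at hx)
    rw [← (hSs ω).exp_eq_mul_transpose] at h
    refine h.trans_eq ?_
    simp only [hR, Pi.add_apply, Pi.smul_apply, Pi.mul_apply, smul_eq_mul, hB, mul_smul_comm,
      trace_smul, hWdef, hE]
    ring
  have hsm : ∀ ω, (S ω + l • X ω).IsSymm := fun ω => (hSs ω).add ((hXs ω).smul l)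
  have hint : Integrable (fun ω => (NormedSpace.exp (S ω + l • X ω)).trace) P := by
    refine hRint.mono' ((continuous_id.matrix_trace.comp hexpc).comp_stronglyMeasurable
      ((hSm.mono hm).add (hXm.const_smul l))).aestronglyMeasurable
      (Filter.Eventually.of_forall fun ω => ?_)
    rw [Real.norm_of_nonneg (hsm ω).trace_exp_nonneg]
    exact hle ω
  refine ⟨hint, ?_⟩
  filter_upwards [condExp_mono (m := m) hint hRint (Filter.Eventually.of_forall hle),
    condExp_add (hBint.smul (a * l)) ((hWY.smul α).add (hW.smul β)) m,
    condExp_add (hWY.smul α) (hW.smul β) m,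
    condExp_smul (μ := P) (a * l) (fun ω => B (E ω) (X ω)) m, condExp_smul (μ := P) α (W * Y) m,
    hBc, hWYc] with ω h1 h2 h3 h4 h5 h6 h7
  refine h1.trans ?_
  have hc : P[β • W | m] = β • W := condExp_of_stronglyMeasurable hm (hWm.const_smul β) (hW.smul β)
  rw [h2, Pi.add_apply, h3, Pi.add_apply, h4, h5, hc]
  simp only [Pi.smul_apply, smul_eq_mul, h6, Pi.zero_apply, mul_zero, zero_add]
  calc α * (P[W * Y | m]) ω + β * W ω ≤ α * (W ω * Real.exp 1) + β * W ω := by gcongr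
    _ = (α * Real.exp 1 + β) * W ω := by ring
    _ ≤ _ := mul_le_mul_of_nonneg_right hαβ (hW0 ω)
end

/-- Conditional bound on the trace moment generating function of a matrix martingale with
light-tailed increments. -/
theorem condExp_trace_exp_sum_le {Ω : Type*} {mΩ : MeasurableSpace Ω} {P : Measure Ω}
    [IsProbabilityMeasure P] {m : ℕ} {n : Type*} [Fintype n] [DecidableEq n]
    (U : Filtration (Fin (m + 1)) mΩ) {σ : Fin m → ℝ} (hσ : ∀ k, σ k ≠ 0)
    {X : Fin m → Ω → Matrix n n ℝ} (hsymm : ∀ k ω, (X k ω).IsSymm)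
    (hadapted : ∀ k, StronglyMeasurable[U k.succ] (X k))
    (hmart : ∀ k, P[X k | U k.castSucc] =ᵐ[P] 0)
    (hexp_int : ∀ k, Integrable (fun ω => Real.exp (‖X k ω‖ ^ 2 / σ k ^ 2)) P)
    (hexp : ∀ k, P[fun ω => Real.exp (‖X k ω‖ ^ 2 / σ k ^ 2) | U k.castSucc]
      ≤ᵐ[P] fun _ => Real.exp 1) (l : ℝ) :
    Integrable (fun ω => (NormedSpace.exp (l • ∑ k, X k ω)).trace) P ∧
      P[fun ω => (NormedSpace.exp (l • ∑ k, X k ω)).trace | U 0] ≤ᵐ[P]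
        fun _ => Fintype.card n * Real.exp (3 / 4 * l ^ 2 * ∑ k, σ k ^ 2) := by
  -- Indices of the increments revealed by time `k`.
  let I : Fin (m + 1) → Finset (Fin m) := fun k => Finset.univ.filter fun j => j.castSucc < k
  have hI0 : I 0 = ∅ := by ext j; simp [I]
  have hIlast : I (Fin.last m) = Finset.univ := by ext j; simp [I, Fin.castSucc_lt_last]
  have hnot : ∀ k : Fin m, k ∉ I k.castSucc := fun k => by simp [I]
  have hIsucc : ∀ k : Fin m, I k.succ = insert k (I k.castSucc) := fun k => by
    ext j
    simp only [I, Finset.mem_filter, Finset.mem_univ, true_and, Finset.mem_insert,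
      Fin.castSucc_lt_succ_iff, Fin.castSucc_lt_castSucc_iff, le_iff_eq_or_lt]
  have key : ∀ k : Fin (m + 1), StronglyMeasurable[U k] (fun ω => ∑ j ∈ I k, X j ω) ∧
      Integrable (fun ω => (NormedSpace.exp (l • ∑ j ∈ I k, X j ω)).trace) P ∧
      P[fun ω => (NormedSpace.exp (l • ∑ j ∈ I k, X j ω)).trace | U 0] ≤ᵐ[P]
        fun _ => Fintype.card n * Real.exp (3 / 4 * l ^ 2 * ∑ j ∈ I k, σ j ^ 2) := by
    intro k
    induction k using Fin.induction with
    | zero =>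
      simp only [hI0, Finset.sum_empty, smul_zero, NormedSpace.exp_zero, Matrix.trace_one, mul_zero,
        Real.exp_zero, mul_one]
      refine ⟨stronglyMeasurable_const, integrable_const _, ?_⟩
      rw [condExp_const (U.le 0)]
    | succ k ih =>
      obtain ⟨hSm, hint, hle⟩ := ih
      simp only [hIsucc, Finset.sum_insert (hnot k)]
      have hS : ∀ ω, (l • ∑ j ∈ I k.castSucc, X j ω).IsSymm := fun ω => by
        rw [Matrix.IsSymm, Matrix.transpose_smul, Matrix.transpose_sum]
        simp only [(hsymm _ ω).eq]
      obtain ⟨hint', hle'⟩ := condExp_trace_exp_add_le (U.le k.castSucc) (hσ k) l hS (hsymm k)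
        (hSm.const_smul l) ((hadapted k).mono (U.le _)) (hmart k) (hexp_int k) (hexp k) hint
      have heq : (fun ω => (NormedSpace.exp (l • (X k ω + ∑ j ∈ I k.castSucc, X j ω))).trace)
          = fun ω => (NormedSpace.exp (l • ∑ j ∈ I k.castSucc, X j ω + l • X k ω)).trace := by
        funext ω; rw [smul_add, add_comm]
      rw [heq]
      refine ⟨(hadapted k).add (hSm.mono (U.mono (Fin.castSucc_lt_succ (i := k)).le)), hint', ?_⟩
      -- Condition the one-step bound down to `U 0`; the tower property then collapses the left
      -- side.
      have hmono := condExp_mono (m := U 0) integrable_condExp (hint.const_mul _) hle'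
      filter_upwards [hle, hmono, condExp_smul (μ := P) (Real.exp (3 / 4 * l ^ 2 * σ k ^ 2))
          (fun ω => (NormedSpace.exp (l • ∑ j ∈ I k.castSucc, X j ω)).trace) (U 0),
        condExp_condExp_of_le (μ := P)
          (f := fun ω => (NormedSpace.exp (l • ∑ j ∈ I k.castSucc, X j ω + l • X k ω)).trace)
          (U.mono (Fin.zero_le k.castSucc)) (U.le k.castSucc)] with ω h1 h2 h3 h4
      rw [h4] at h2
      refine h2.trans (h3.trans_le ?_)
      rw [Pi.smul_apply, smul_eq_mul, mul_add, Real.exp_add, mul_left_comm]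
      gcongr
  simpa only [hIlast] using (key (Fin.last m)).2

/-! ### The tail bound. -/

theorem lemma4p1 {Ω : Type*} [mΩ : MeasurableSpace Ω] (P : Measure Ω) [IsProbabilityMeasure P]
    (m n : ℕ) (hm : 1 ≤ m)
    (U : Filtration (Fin (m + 1)) mΩ)
    (σ : EuclideanSpace ℝ (Fin m)) (hσ : ∀ k, σ k ≠ 0)
    (X : Fin m → Ω → Matrix (Fin n) (Fin n) ℝ)
    (hsymm : ∀ k ω, (X k ω).IsSymm)
    (hadapted : ∀ k, StronglyMeasurable[U k.succ] (X k))
    (hmart : ∀ k, P[X k | U k.castSucc] =ᵐ[P] 0)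
    (hexp_int : ∀ k, Integrable (fun ω => Real.exp (‖X k ω‖ ^ 2 / σ k ^ 2)) P)
    (hexp : ∀ k, P[fun ω => Real.exp (‖X k ω‖ ^ 2 / σ k ^ 2) | U k.castSucc]
      ≤ᵐ[P] fun _ => Real.exp 1) :
    ∀ τ : ℝ, 0 < τ →
      P⟦{ω | τ * ‖σ‖ ≤ ‖∑ k, X k ω‖} | U 0⟧
        ≤ᵐ[P] fun _ => 2 * (n : ℝ) * Real.exp (-τ ^ 2 / 3) := by
  intro τ hτ
  have hσ0 : 0 < ‖σ‖ := norm_pos_iff.2 fun h => hσ ⟨0, hm⟩ (by simp [h])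
  have hσ2 : ∑ k, σ k ^ 2 = ‖σ‖ ^ 2 := by simp [EuclideanSpace.norm_sq_eq]
  -- Minimizer of `3/4 l² ‖σ‖² - l τ ‖σ‖`, with minimum `-τ²/3`.
  obtain ⟨l, hl⟩ : ∃ l, l = 2 * τ / (3 * ‖σ‖) := ⟨_, rfl⟩
  have hl0 : 0 < l := by rw [hl]; positivity
  obtain ⟨hi₁, hc₁⟩ := condExp_trace_exp_sum_le U hσ hsymm hadapted hmart hexp_int hexp l
  obtain ⟨hi₂, hc₂⟩ := condExp_trace_exp_sum_le U hσ hsymm hadapted hmart hexp_int hexp (-l)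
  have hSs : ∀ ω (c : ℝ), (c • ∑ k, X k ω).IsSymm := fun ω c => by
    rw [Matrix.IsSymm, Matrix.transpose_smul, Matrix.transpose_sum]
    simp only [(hsymm _ ω).eq]
  have hmeas : MeasurableSet {ω | τ * ‖σ‖ ≤ ‖∑ k, X k ω‖} := by
    refine measurableSet_le measurable_const ?_
    exact (Finset.stronglyMeasurable_fun_sum Finset.univ fun k _ =>
      (hadapted k).mono (U.le _)).norm.measurable
  set F : Ω → ℝ := (fun ω => (NormedSpace.exp (l • ∑ k, X k ω)).trace)
    + fun ω => (NormedSpace.exp (-l • ∑ k, X k ω)).trace with hF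
  have hFi : Integrable F P := hi₁.add hi₂
  have hF0 : ∀ ω, 0 ≤ F ω := fun ω =>
    add_nonneg (hSs ω l).trace_exp_nonneg (hSs ω (-l)).trace_exp_nonneg
  have hle : ∀ ω, {ω | τ * ‖σ‖ ≤ ‖∑ k, X k ω‖}.indicator (fun _ => (1 : ℝ)) ω
      ≤ (Real.exp (-(l * (τ * ‖σ‖))) • F) ω := fun ω => by
    refine Set.indicator_apply_le' (fun hω => ?_)
      fun _ => mul_nonneg (Real.exp_pos _).le (hF0 ω)
    replace hω : τ * ‖σ‖ ≤ ‖∑ k, X k ω‖ := hω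
    have hS0 : 0 < ‖∑ k, X k ω‖ := (mul_pos hτ hσ0).trans_le hω
    -- For `n = 0` the norm vanishes, so the event is empty.
    have hn : Nonempty (Fin n) := by
      by_contra h
      rw [not_nonempty_iff] at h
      exact norm_pos_iff.1 hS0 (Subsingleton.elim _ _)
    have h1 := (hSs ω l).exp_norm_le_trace_exp_add
    rw [norm_smul, Real.norm_of_nonneg hl0.le, ← neg_smul] at h1
    have h2 : Real.exp (l * (τ * ‖σ‖)) ≤ F ω :=
      (Real.exp_le_exp.2 (mul_le_mul_of_nonneg_left hω hl0.le)).trans h1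
    calc (1 : ℝ) = Real.exp (-(l * (τ * ‖σ‖))) * Real.exp (l * (τ * ‖σ‖)) := by
          rw [← Real.exp_add]; simp
      _ ≤ Real.exp (-(l * (τ * ‖σ‖))) * F ω := by gcongr
  filter_upwards [hc₁, hc₂, condExp_add hi₁ hi₂ (U 0),
    condExp_smul (μ := P) (Real.exp (-(l * (τ * ‖σ‖)))) F (U 0),
    condExp_mono (m := U 0) ((integrable_const (1 : ℝ)).indicator hmeas)
      (hFi.smul (Real.exp (-(l * (τ * ‖σ‖))))) (Filter.Eventually.of_forall hle)]
    with ω h1 h2 h3 h4 h5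
  refine h5.trans ?_
  rw [h4, Pi.smul_apply, smul_eq_mul, hF, h3, Pi.add_apply]
  rw [Fintype.card_fin, hσ2] at h1 h2
  rw [neg_sq] at h2
  have hexps : Real.exp (-(l * (τ * ‖σ‖))) * Real.exp (3 / 4 * l ^ 2 * ‖σ‖ ^ 2)
      = Real.exp (-τ ^ 2 / 3) := by
    rw [← Real.exp_add, hl]
    congr 1
    field_simp
    ring
  calc _ ≤ Real.exp (-(l * (τ * ‖σ‖))) * (n * Real.exp (3 / 4 * l ^ 2 * ‖σ‖ ^ 2)
        + n * Real.exp (3 / 4 * l ^ 2 * ‖σ‖ ^ 2)) :=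
        mul_le_mul_of_nonneg_left (add_le_add h1 h2) (Real.exp_pos _).le
    _ = 2 * n * (Real.exp (-(l * (τ * ‖σ‖))) * Real.exp (3 / 4 * l ^ 2 * ‖σ‖ ^ 2)) := by ring
    _ = _ := by rw [hexps]
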